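/- Let $r\ge 2$ be an integer. For each $n\ge 1$ consider an urn with $n$ balls of $n$ different colours, exactly one ball of each colour (the classical birthday case). Balls are drawn independently, uniformly and with replacement; let $Z_i(k)$ be the number of times colour $i$ occurs among the first $k$ draws, and let $$R_r=\inf\{k\ge 1:\ Z_i(k)\ge r \text{ for some } i\in\{1,\dots,n\}\}$$ be the time of the first $r$-fold repetition. Let $q_r(y)=\sum_{i=0}^{r-1}y^i/i!$, let $y(t)$ be the inverse function of $y\mapsto t=\bigl(r!\,(y-\log q_r(y))\bigr)^{1/r}$ on $[0,\infty)$, and for $t>0$ put $g_r(t)=\frac{t^{r-1}}{y(t)^{r-1}}\,q_r(y(t))$. Then, for all sufficiently small $t>0$, $g_r(t)=\sum_{i\ge 0}a_i(r)\,t^i$ with a convergent power series whose real coefficients $a_i(r)$ depend only on $r$; moreover $\mathbb E(R_r)<\infty$ for every $n$, and $\mathbb E(R_r)/n$ has, as $n\to\infty$, the asymptotic expansion in powers of $n^{-1/r}$ $$\frac{\mathbb E(R_r)}{n}\ \sim\ \frac1r\sum_{i=0}^{\infty}a_i(r)\,\Gamma\!\left(\tfrac{i+1}{r}\right)\left(\frac{r!}{n}\right)^{(i+1)/r},$$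 that is, for every integer $N\ge 0$, $$\frac{\mathbb E(R_r)}{n}=\frac1r\sum_{i=0}^{N-1}a_i(r)\,\Gamma\!\left(\tfrac{i+1}{r}\right)\left(\frac{r!}{n}\right)^{(i+1)/r}+O\!\left(n^{-(N+1)/r}\right)\qquad(n\to\infty).$$ -/

import Mathlib

open MeasureTheory ProbabilityTheory Filter Asymptotics

noncomputable section

namespace Birthday

/-- `x_i`, the number of balls of colour `i`, if the ball `b` has the colour `h b`. -/
def configuration {n m : ℕ} (h : Fin n → Fin m) (i : Fin m) : ℕ :=
  (Finset.univ.filter fun b => h b = i).card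

/-- `D 0, D 1, …` are the balls drawn, with replacement, from an urn of `n` distinguishable balls:
the draws are independent and each is uniform on the `n` balls. -/
structure IsDrawingWithReplacement {Ω : Type*} [MeasurableSpace Ω] (P : Measure Ω) {n : ℕ}
    (D : ℕ → Ω → Fin n) : Prop where
  measurable : ∀ j, Measurable (D j)
  indep : iIndepFun D P
  uniform : ∀ j b, P (D j ⁻¹' {b}) = (n : ENNReal)⁻¹

/-- `Z_i(k)`, the number of balls of colour `i` among the first `k` draws. -/
def occupancy {Ω : Type*} {n m : ℕ} (h : Fin n → Fin m) (D : ℕ → Ω → Fin n)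
    (i : Fin m) (k : ℕ) (ω : Ω) : ℕ :=
  ((Finset.range k).filter fun j => h (D j ω) = i).card

/-- `R_r`, the time of the first `r`-fold repetition of a colour; `⊤` if there is none. -/
def repetitionTime {Ω : Type*} {n m : ℕ} (h : Fin n → Fin m) (D : ℕ → Ω → Fin n)
    (r : ℕ) (ω : Ω) : ℕ∞ :=
  sInf ((fun k : ℕ => (k : ℕ∞)) '' {k : ℕ | 1 ≤ k ∧ ∃ i : Fin m, r ≤ occupancy h D i k ω})

/-- `E(R_r)`, as an extended nonnegative number. -/
def expectedRepetitionTime {Ω : Type*} [MeasurableSpace Ω] (P : Measure Ω) {n m : ℕ}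
    (h : Fin n → Fin m) (D : ℕ → Ω → Fin n) (r : ℕ) : ENNReal :=
  ∫⁻ ω, (repetitionTime h D r ω : ENNReal) ∂P

/-- `q_r(y) = ∑_{i < r} y^i / i!`. -/
def q (r : ℕ) (y : ℝ) : ℝ :=
  ∑ i ∈ Finset.range r, y ^ i / (i.factorial : ℝ)

/-- The substitution `t = (r! (y - log q_r(y)))^{1/r}`, for `y ≥ 0`. -/
def tOf (r : ℕ) (y : ℝ) : ℝ :=
  ((r.factorial : ℝ) * (y - Real.log (q r y))) ^ (1 / (r : ℝ))

/-- `y(t)`, the inverse of `y ↦ tOf r y` on `[0, ∞)`. -/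
def yOf (r : ℕ) (t : ℝ) : ℝ :=
  Function.invFunOn (tOf r) (Set.Ici 0) t

/-- `g_r(t) = (t / y(t))^{r-1} q_r(y(t))`, for `t > 0`. -/
def g (r : ℕ) (t : ℝ) : ℝ :=
  t ^ (r - 1) / yOf r t ^ (r - 1) * q r (yOf r t)

end Birthday

end

/-! The mean of `R_r` is the sum over `k` of the probabilities that no colour has occurred `r` times
in `k` draws. Each of these is the number of sparse words of length `k` divided by `n ^ k`. Sparse
words have exponential generating function `q r y ^ n`, and integrating `y ^ k` against `exp (-n y)`
yields `k! / n ^ (k+1)`. The sum therefore becomes `n` times the Laplace integral of `exp (-n *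
phase r y)` (`integral_q_pow_mul_exp`, `expectedRepetitionTime_eq`).

The phase increases from 0 and its derivative is `y ^ (r-1) / ((r-1)! q_r(y))`, so it vanishes to
order exactly `r` at 0. Hence `phase = t ^ r / r!` defines an analytic change of variable `y = Y t`
near 0, with `Y' = g r` for small `t > 0` (`exists_analyticAt_inverse`). The `a i` are the Taylor
coefficients of `Y'`. Watson's lemma (`isBigO_watson`) integrates them term by term into Gamma
values, and the part away from 0 is exponentially small. -/

namespace Birthday

/-! ### Counting sparse words by a Laplace integral -/

/-- The number of words with prescribed letter counts is a multinomial coefficient. -/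
theorem card_letterCount_eq_multinomial {α : Type*} [Fintype α] [DecidableEq α] {k : ℕ} {c : α → ℕ}
    (hc : ∑ i, c i = k) :
    (Finset.univ.filter fun f : Fin k → α =>
      ∀ i, (Finset.univ.filter fun j => f j = i).card = c i).card
      = Nat.multinomial Finset.univ c := by
  -- Expand `(∑ X_i) ^ k` once over words and once by the multinomial theorem, then compare the
  -- coefficients of the monomial with exponent `c`.
  have key := Fintype.sum_pow (fun i : α => (MvPolynomial.X i : MvPolynomial α ℕ)) k
  rw [Finset.sum_pow_eq_sum_piAntidiag] at key
  have hmon : ∀ d : α → ℕ, ∏ i, (MvPolynomial.X i : MvPolynomial α ℕ) ^ d i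
      = MvPolynomial.monomial (Finsupp.equivFunOnFinite.symm d) 1 := by
    intro d
    rw [MvPolynomial.monomial_eq, Finsupp.prod_fintype _ _ (by simp)]
    simp
  have hword : ∀ f : Fin k → α, ∏ j, (MvPolynomial.X (f j) : MvPolynomial α ℕ)
      = ∏ i, (MvPolynomial.X i : MvPolynomial α ℕ) ^ (Finset.univ.filter fun j => f j = i).card := by
    intro f
    rw [← Finset.prod_fiberwise Finset.univ f]
    refine Finset.prod_congr rfl fun i _ => ?_
    rw [← Finset.prod_const]
    refine Finset.prod_congr rfl fun j hj => ?_
    rw [(Finset.mem_filter.1 hj).2]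
  have := congrArg (MvPolynomial.coeff (Finsupp.equivFunOnFinite.symm c)) key
  simp only [hword, hmon, MvPolynomial.coeff_sum, MvPolynomial.coeff_monomial,
    EmbeddingLike.apply_eq_iff_eq] at this
  rw [Finset.card_filter]
  simp only [← funext_iff]
  rw [← this, Finset.sum_eq_single c]
  · rw [← map_natCast MvPolynomial.C, MvPolynomial.coeff_C_mul,
      MvPolynomial.coeff_monomial, if_pos rfl]
    simp
  · intro b _ hb
    rw [← map_natCast MvPolynomial.C, MvPolynomial.coeff_C_mul,
      MvPolynomial.coeff_monomial, if_neg (by simpa using hb)]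
    simp
  · intro hn
    exact absurd (by simp [hc]) hn

/-- The words of length `k` in which every letter occurs less than `r` times. -/
def sparseWords (n r k : ℕ) : Finset (Fin k → Fin n) :=
  Finset.univ.filter fun f => ∀ i, (Finset.univ.filter fun j => f j = i).card < r

theorem card_sparseWords (n r k : ℕ) :
    (sparseWords n r k).card
      = ∑ c ∈ (Fintype.piFinset fun _ : Fin n => Finset.range r).filter (fun c => ∑ i, c i = k),
          Nat.multinomial Finset.univ c := by
  rw [Finset.card_eq_sum_card_fiberwise
    (f := fun f i => (Finset.univ.filter fun j => f j = i).card)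
    (t := (Fintype.piFinset fun _ : Fin n => Finset.range r).filter (fun c => ∑ i, c i = k))]
  · refine Finset.sum_congr rfl fun c hc => ?_
    rw [Finset.mem_filter, Fintype.mem_piFinset] at hc
    rw [← card_letterCount_eq_multinomial hc.2]
    congr 1
    ext f
    simp only [sparseWords, Finset.mem_filter, Finset.mem_univ, true_and, funext_iff]
    refine ⟨fun h => h.2, fun h => ⟨fun i => ?_, h⟩⟩
    rw [h i]
    exact Finset.mem_range.1 (hc.1 i)
  · intro f hf
    simp only [sparseWords, Finset.coe_filter, Finset.mem_univ, true_and, Set.mem_ofPred_eq] at hf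
    simp only [Finset.coe_filter, Fintype.mem_piFinset, Finset.mem_range, Set.mem_ofPred_eq]
    refine ⟨hf, ?_⟩
    rw [← Finset.card_eq_sum_card_fiberwise (fun _ _ => Finset.mem_coe.2 (Finset.mem_univ _))]
    simp

theorem integral_pow_mul_exp_neg_mul_Ioi (k : ℕ) {b : ℝ} (hb : 0 < b) :
    IntegrableOn (fun y : ℝ => y ^ k * Real.exp (-(b * y))) (Set.Ioi 0) ∧
      ∫ y in Set.Ioi (0 : ℝ), y ^ k * Real.exp (-(b * y)) = k.factorial / b ^ (k + 1) := by
  have hk : (0 : ℝ) < (k : ℝ) + 1 := by positivity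
  constructor
  · have := integrableOn_rpow_mul_exp_neg_mul_rpow (p := 1) (s := k) (b := b)
      (by linarith) one_pos hb
    simpa using this
  · have := Real.integral_rpow_mul_exp_neg_mul_Ioi hk hb
    simp only [add_sub_cancel_right, Real.rpow_natCast] at this
    rw [this, Real.Gamma_nat_eq_factorial]
    rw [show (k : ℝ) + 1 = ((k + 1 : ℕ) : ℝ) by push_cast; rfl, Real.rpow_natCast,
      one_div, inv_pow, div_eq_inv_mul]

theorem q_pow_eq_sum (n r : ℕ) (y : ℝ) :
    q r y ^ n = ∑ c ∈ Fintype.piFinset fun _ : Fin n => Finset.range r,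
      (∏ i, ((c i).factorial : ℝ))⁻¹ * y ^ ∑ i, c i := by
  have := Finset.prod_univ_sum (fun _ : Fin n => Finset.range r)
    (fun (_ : Fin n) (j : ℕ) => y ^ j / (j.factorial : ℝ))
  simp only [Finset.prod_const, Finset.card_univ, Fintype.card_fin] at this
  rw [q, this]
  refine Finset.sum_congr rfl fun c _ => ?_
  rw [Finset.prod_div_distrib, Finset.prod_pow_eq_pow_sum, div_eq_inv_mul]

/-- The Laplace integral of `q_r ^ n` counts the sparse words. -/
theorem integral_q_pow_mul_exp {n : ℕ} (hn : 0 < n) (r : ℕ) {K : ℕ} (hK : n * (r - 1) < K) :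
    IntegrableOn (fun y => q r y ^ n * Real.exp (-(n * y))) (Set.Ioi 0) ∧
    ∑ k ∈ Finset.range K, ((sparseWords n r k).card : ℝ) * ((n : ℝ)⁻¹) ^ k
      = n * ∫ y in Set.Ioi (0 : ℝ), q r y ^ n * Real.exp (-(n * y)) := by
  have hn' : (0 : ℝ) < n := by exact_mod_cast hn
  have hint : ∀ c ∈ Fintype.piFinset fun _ : Fin n => Finset.range r,
      IntegrableOn (fun y : ℝ => (∏ i, ((c i).factorial : ℝ))⁻¹ *
        (y ^ (∑ i, c i) * Real.exp (-(n * y)))) (Set.Ioi 0) := fun c _ =>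
    (integral_pow_mul_exp_neg_mul_Ioi _ hn').1.const_mul _
  simp only [q_pow_eq_sum, Finset.sum_mul, mul_assoc]
  refine ⟨integrable_finsetSum _ hint, ?_⟩
  rw [integral_finsetSum _ hint, Finset.mul_sum]
  simp only [integral_const_mul, (integral_pow_mul_exp_neg_mul_Ioi _ hn').2]
  simp only [card_sparseWords, Nat.cast_sum, Finset.sum_mul]
  -- Group the count vectors by their total `k`. No total exceeds `n * (r - 1)`, so `K` truncates
  -- nothing.
  rw [← Finset.sum_fiberwise_of_maps_to (t := Finset.range K) (g := fun c : Fin n → ℕ => ∑ i, c i)]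
  · refine Finset.sum_congr rfl fun k _ => Finset.sum_congr rfl fun c hc => ?_
    rw [(Finset.mem_filter.1 hc).2]
    have hm := Nat.multinomial_spec Finset.univ c
    rw [(Finset.mem_filter.1 hc).2] at hm
    have hm' : (∏ i, ((c i).factorial : ℝ)) * (Nat.multinomial Finset.univ c : ℝ)
        = (k.factorial : ℝ) := by exact_mod_cast hm
    have hp : (0 : ℝ) < ∏ i, ((c i).factorial : ℝ) := Finset.prod_pos fun i _ => by positivity
    rw [← hm', inv_pow]
    field_simp
    ring
  · intro c hc
    rw [Finset.mem_range]
    refine lt_of_le_of_lt ?_ hK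
    calc ∑ i, c i ≤ ∑ _i : Fin n, (r - 1) := Finset.sum_le_sum fun i _ => by
          have := Finset.mem_range.1 (Fintype.mem_piFinset.1 hc i)
          omega
      _ = n * (r - 1) := by simp

/-! ### The repetition time and the probabilities of words -/

theorem occupancy_mono {Ω : Type*} {n m : ℕ} (h : Fin n → Fin m) (D : ℕ → Ω → Fin n) (i : Fin m)
    (ω : Ω) : Monotone fun k => occupancy h D i k ω := fun _ _ hkl =>
  Finset.card_le_card (Finset.filter_subset_filter _ (Finset.range_mono hkl))

theorem sum_occupancy {Ω : Type*} {n m : ℕ} (h : Fin n → Fin m) (D : ℕ → Ω → Fin n) (k : ℕ)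
    (ω : Ω) : ∑ i, occupancy h D i k ω = k := by
  simp only [occupancy]
  rw [← Finset.card_eq_sum_card_fiberwise (fun _ _ => Finset.mem_coe.2 (Finset.mem_univ _))]
  simp

open Classical in
/-- The repetition time counts the times at which no colour has occurred `r` times. -/
theorem repetitionTime_eq_sum {Ω : Type*} {n m : ℕ} (h : Fin n → Fin m) (D : ℕ → Ω → Fin n)
    {r : ℕ} (hr : 1 ≤ r) {K : ℕ} (hK : m * (r - 1) < K) (ω : Ω) :
    (repetitionTime h D r ω : ENNReal)
      = ∑ k ∈ Finset.range K, {ω | ∀ i, occupancy h D i k ω < r}.indicator 1 ω := by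
  -- Pigeonhole: more than `m * (r - 1)` draws force a colour to occur `r` times.
  have hKr : 1 ≤ K ∧ ∃ i : Fin m, r ≤ occupancy h D i K ω := by
    refine ⟨by omega, ?_⟩
    by_contra! hcon
    have h1 := sum_occupancy h D K ω
    have h2 : ∑ i, occupancy h D i K ω ≤ ∑ _i : Fin m, (r - 1) :=
      Finset.sum_le_sum fun i _ => by have := hcon i; omega
    simp only [Finset.sum_const, Finset.card_univ, Fintype.card_fin, smul_eq_mul] at h2
    omega
  have hex : ∃ k, 1 ≤ k ∧ ∃ i : Fin m, r ≤ occupancy h D i k ω := ⟨K, hKr⟩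
  have hle : Nat.find hex ≤ K := Nat.find_min' hex hKr
  have hR : repetitionTime h D r ω = (Nat.find hex : ℕ∞) := by
    refine le_antisymm (sInf_le ⟨_, Nat.find_spec hex, rfl⟩) (le_sInf ?_)
    rintro _ ⟨k, hk, rfl⟩
    exact Nat.cast_le.2 (Nat.find_min' hex hk)
  have hiff : ∀ k, (∀ i, occupancy h D i k ω < r) ↔ k < Nat.find hex := by
    intro k
    constructor
    · intro hk
      by_contra! hcon
      obtain ⟨-, i, hi⟩ := Nat.find_spec hex
      exact absurd (hi.trans (occupancy_mono h D i ω hcon)) (not_le.2 (hk i))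
    · intro hk i
      by_contra! hcon
      refine Nat.find_min hex hk ⟨?_, i, hcon⟩
      -- The constraint `1 ≤ k` in the infimum is harmless: at time 0 every occupancy is 0, which is
      -- less than `r`.
      by_contra! h0
      have : k = 0 := by omega
      subst this
      simp [occupancy] at hcon
      omega
  rw [hR]
  simp only [Set.indicator_apply, Set.mem_ofPred_eq, hiff, Pi.one_apply]
  rw [Finset.sum_boole]
  have : (Finset.range K).filter (fun k => k < Nat.find hex) = Finset.range (Nat.find hex) := by
    ext k
    simp only [Finset.mem_filter, Finset.mem_range]
    omega
  rw [this]
  simp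

theorem injective_of_configuration_eq_one {n m : ℕ} {h : Fin n → Fin m}
    (hh : ∀ i, configuration h i = 1) : Function.Injective h := by
  intro a b hab
  obtain ⟨c, hc⟩ := Finset.card_eq_one.1 (hh (h b))
  have ha : a ∈ ({c} : Finset (Fin n)) := hc ▸ by simp [hab]
  have hb : b ∈ ({c} : Finset (Fin n)) := hc ▸ by simp
  rw [Finset.mem_singleton.1 ha, Finset.mem_singleton.1 hb]

theorem surjective_of_configuration_eq_one {n m : ℕ} {h : Fin n → Fin m}
    (hh : ∀ i, configuration h i = 1) : Function.Surjective h := by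
  intro i
  obtain ⟨c, hc⟩ := Finset.card_eq_one.1 (hh i)
  have : c ∈ Finset.univ.filter fun b => h b = i := hc ▸ by simp
  exact ⟨c, (Finset.mem_filter.1 this).2⟩

/-- With one ball per colour, `h` is a bijection, so colours may be replaced by balls and the event
depends only on the word drawn. -/
theorem setOf_occupancy_lt {Ω : Type*} {n : ℕ} {D : ℕ → Ω → Fin n} {h : Fin n → Fin n}
    (hh : ∀ i, configuration h i = 1) (r k : ℕ) :
    {ω | ∀ i, occupancy h D i k ω < r}
      = (fun ω (j : Fin k) => D j ω) ⁻¹' (sparseWords n r k : Set (Fin k → Fin n)) := by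
  ext ω
  have hocc : ∀ b, occupancy h D (h b) k ω
      = (Finset.univ.filter fun j : Fin k => D j ω = b).card := by
    intro b
    simp only [occupancy, (injective_of_configuration_eq_one hh).eq_iff]
    rw [Finset.card_filter, Finset.card_filter, ← Fin.sum_univ_eq_sum_range
      (fun j => if D j ω = b then 1 else 0)]
  simp only [Set.mem_ofPred_eq, sparseWords, Set.mem_preimage, Finset.coe_filter, Finset.mem_univ,
    true_and]
  rw [(surjective_of_configuration_eq_one hh).forall]
  simp only [hocc]

section Drawing

variable {Ω : Type*} [MeasurableSpace Ω] {P : Measure Ω} {n : ℕ} {D : ℕ → Ω → Fin n}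

theorem IsDrawingWithReplacement.measurable_word (hD : IsDrawingWithReplacement P D) (k : ℕ) :
    Measurable fun ω (j : Fin k) => D j ω :=
  measurable_pi_lambda _ fun j => hD.measurable j

theorem IsDrawingWithReplacement.measure_word (hD : IsDrawingWithReplacement P D) {k : ℕ}
    (f : Fin k → Fin n) :
    P ((fun ω (j : Fin k) => D j ω) ⁻¹' {f}) = ((n : ENNReal)⁻¹) ^ k := by
  have hi : iIndepFun (fun j : Fin k => D j) P := hD.indep.precomp Fin.val_injective
  have := hi.measure_inter_preimage_eq_mul Finset.univ (sets := fun j => {f j})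
    fun j _ => measurableSet_singleton _
  simp only [hD.uniform, Finset.prod_const, Finset.card_univ, Fintype.card_fin] at this
  rw [← this]
  congr 1
  ext ω
  simp [funext_iff]

/-- The mean of the repetition time as a Laplace integral. -/
theorem expectedRepetitionTime_eq {h : Fin n → Fin n} (hn : 0 < n)
    (hh : ∀ i, configuration h i = 1) (hD : IsDrawingWithReplacement P D) {r : ℕ} (hr : 1 ≤ r) :
    expectedRepetitionTime P h D r
      = ENNReal.ofReal (n * ∫ y in Set.Ioi (0 : ℝ), q r y ^ n * Real.exp (-(n * y))) := by
  have hset : ∀ k, P {ω | ∀ i, occupancy h D i k ω < r}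
      = ENNReal.ofReal (((sparseWords n r k).card : ℝ) * ((n : ℝ)⁻¹) ^ k) := by
    intro k
    rw [setOf_occupancy_lt hh, ← sum_measure_preimage_singleton]
    · simp only [hD.measure_word, Finset.sum_const, nsmul_eq_mul]
      rw [ENNReal.ofReal_mul (by positivity), ENNReal.ofReal_pow (by positivity),
        ENNReal.ofReal_inv_of_pos (by exact_mod_cast hn)]
      simp
    · intro f _
      exact hD.measurable_word k (measurableSet_singleton f)
  have hmeas : ∀ k, MeasurableSet {ω | ∀ i, occupancy h D i k ω < r} := by
    intro k
    rw [setOf_occupancy_lt hh]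
    exact hD.measurable_word k (Finset.measurableSet _)
  rw [← (integral_q_pow_mul_exp hn r (Nat.lt_succ_self _)).2, expectedRepetitionTime,
    ENNReal.ofReal_sum_of_nonneg (fun k _ => by positivity)]
  simp only [repetitionTime_eq_sum h D hr (Nat.lt_succ_self _)]
  rw [lintegral_finsetSum _ fun k _ => measurable_one.indicator (hmeas k)]
  refine Finset.sum_congr rfl fun k _ => ?_
  rw [lintegral_indicator_one (hmeas k), hset]

end Drawing

end Birthday

/-! ### The phase function -/

namespace Birthday

open Topology

/-- The phase function `y - log q_r(y)`. -/
noncomputable def phase (r : ℕ) (y : ℝ) : ℝ := y - Real.log (q r y)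

theorem q_succ (s : ℕ) (y : ℝ) : q (s + 1) y = q s y + y ^ s / s.factorial :=
  Finset.sum_range_succ _ _

theorem q_zero_right {r : ℕ} (hr : 1 ≤ r) : q r 0 = 1 := by
  obtain ⟨s, rfl⟩ : ∃ s, r = s + 1 := ⟨r - 1, by omega⟩
  rw [q, Finset.sum_range_succ']
  simp

theorem q_pos {r : ℕ} (hr : 1 ≤ r) {y : ℝ} (hy : 0 ≤ y) : 0 < q r y := by
  obtain ⟨s, rfl⟩ : ∃ s, r = s + 1 := ⟨r - 1, by omega⟩
  rw [q, Finset.sum_range_succ']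
  have : 0 ≤ ∑ i ∈ Finset.range s, y ^ (i + 1) / ((i + 1).factorial : ℝ) :=
    Finset.sum_nonneg fun i _ => by positivity
  simpa using by linarith

theorem hasDerivAt_q_succ (s : ℕ) (y : ℝ) : HasDerivAt (q (s + 1)) (q s y) y := by
  induction s with
  | zero =>
    have : q (0 + 1) = fun _ => 1 := by funext y; simp [q]
    rw [this]
    simpa [q] using hasDerivAt_const y (1 : ℝ)
  | succ s ih =>
    have : q (s + 1 + 1) = fun y => q (s + 1) y + y ^ (s + 1) / ((s + 1).factorial : ℝ) := by
      funext y
      exact q_succ _ _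
    rw [this, q_succ s y]
    refine ih.add ?_
    convert! (hasDerivAt_pow (s + 1) y).div_const ((s + 1).factorial : ℝ) using 1
    rw [Nat.factorial_succ]
    push_cast
    field_simp

theorem continuous_q (r : ℕ) : Continuous (q r) := by
  unfold q
  fun_prop

theorem analyticAt_q (r : ℕ) (y : ℝ) : AnalyticAt ℝ (q r) y := by
  have : q r = fun y => ∑ i ∈ Finset.range r, y ^ i / (i.factorial : ℝ) := rfl
  rw [this]
  fun_prop

theorem phase_zero_right {r : ℕ} (hr : 1 ≤ r) : phase r 0 = 0 := by
  simp [phase, q_zero_right hr]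

/-- Since `q (s+1)` has derivative `q s`, the numerator of `1 - q'/q` collapses to the single top
term `y ^ s / s!`. This gives both strict monotonicity and the order of vanishing at 0. -/
theorem hasDerivAt_phase (s : ℕ) {y : ℝ} (hy : 0 < q (s + 1) y) :
    HasDerivAt (phase (s + 1)) (y ^ s * (s.factorial * q (s + 1) y)⁻¹) y := by
  convert! (hasDerivAt_id y).sub ((hasDerivAt_q_succ s y).log hy.ne') using 1
  have h := q_succ s y
  rw [show q s y = q (s + 1) y - y ^ s / s.factorial by linarith]
  field_simp
  ring

theorem continuousOn_phase {r : ℕ} (hr : 1 ≤ r) : ContinuousOn (phase r) (Set.Ici 0) :=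
  continuousOn_id.sub ((continuous_q r).continuousOn.log fun _ hy => (q_pos hr hy).ne')

theorem strictMonoOn_phase {r : ℕ} (hr : 1 ≤ r) : StrictMonoOn (phase r) (Set.Ici 0) := by
  refine strictMonoOn_of_deriv_pos (convex_Ici 0) (continuousOn_phase hr) fun y hy => ?_
  rw [interior_Ici, Set.mem_Ioi] at hy
  obtain ⟨s, rfl⟩ : ∃ s, r = s + 1 := ⟨r - 1, by omega⟩
  have := q_pos hr hy.le
  rw [(hasDerivAt_phase s this).deriv]
  positivity

theorem phase_nonneg {r : ℕ} (hr : 1 ≤ r) {y : ℝ} (hy : 0 ≤ y) : 0 ≤ phase r y := by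
  rw [← phase_zero_right hr]
  exact (strictMonoOn_phase hr).monotoneOn Set.self_mem_Ici hy hy

theorem injOn_tOf {r : ℕ} (hr : 1 ≤ r) : Set.InjOn (tOf r) (Set.Ici 0) := by
  intro x hx y hy hxy
  have hr0 : (1 / (r : ℝ)) ≠ 0 := by positivity
  have hpx := phase_nonneg hr hx
  have hpy := phase_nonneg hr hy
  have := (Real.rpow_left_inj (by unfold phase at hpx; positivity)
    (by unfold phase at hpy; positivity) hr0).1 hxy
  exact (strictMonoOn_phase hr).injOn hx hy
    (mul_left_cancel₀ (by positivity : (r.factorial : ℝ) ≠ 0) this)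

theorem exp_neg_mul_phase {r : ℕ} (hr : 1 ≤ r) (n : ℕ) {y : ℝ} (hy : 0 ≤ y) :
    Real.exp (-(n * phase r y)) = q r y ^ n * Real.exp (-(n * y)) := by
  have := q_pos hr hy
  rw [phase, show -(n * (y - Real.log (q r y))) = n * Real.log (q r y) + -(n * y) by ring,
    Real.exp_add, Real.exp_nat_mul, Real.exp_log this]

/-! ### Factoring and inverting the phase near 0 -/

/-- Comparison of values at `0` after division by a power. -/
theorem eq_zero_pow_mul_of_pow_mul_eventuallyEq {a d : ℕ} {w u : ℝ → ℝ} (hw : ContinuousAt w 0)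
    (hu : ContinuousAt u 0) (h : ∀ᶠ y in 𝓝 0, y ^ a * w y = y ^ (a + d) * u y) :
    w 0 = 0 ^ d * u 0 := by
  have h1 : Tendsto w (𝓝[≠] 0) (𝓝 (w 0)) := hw.tendsto.mono_left nhdsWithin_le_nhds
  have h2 : Tendsto (fun y => y ^ d * u y) (𝓝[≠] 0) (𝓝 (0 ^ d * u 0)) :=
    ((continuousAt_id.pow d).mul hu).tendsto.mono_left nhdsWithin_le_nhds
  refine tendsto_nhds_unique h1 (h2.congr' ?_)
  filter_upwards [h.filter_mono nhdsWithin_le_nhds, self_mem_nhdsWithin] with y hy hy0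
  rw [pow_add, mul_assoc] at hy
  exact (mul_left_cancel₀ (pow_ne_zero a hy0) hy).symm

/-- An analytic function vanishing at `0` whose derivative is `y ^ s * w y` with `w 0 ≠ 0` is
`y ^ (s + 1) * ψ y` with `ψ` analytic. -/
theorem exists_eventually_eq_pow_succ_mul {f w : ℝ → ℝ} {s : ℕ} (hf : AnalyticAt ℝ f 0)
    (hf0 : f 0 = 0) (hw : ContinuousAt w 0) (hw0 : w 0 ≠ 0)
    (hd : ∀ᶠ y in 𝓝 0, deriv f y = y ^ s * w y) :
    ∃ ψ : ℝ → ℝ, AnalyticAt ℝ ψ 0 ∧ ψ 0 = w 0 / (s + 1) ∧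
      ∀ᶠ y in 𝓝 0, f y = y ^ (s + 1) * ψ y := by
  have hne : ¬∀ᶠ z in 𝓝 0, f z = 0 := by
    intro hz
    have hz' : f =ᶠ[𝓝 0] fun _ => 0 := hz
    refine hw0 ?_
    have := eq_zero_pow_mul_of_pow_mul_eventuallyEq (a := s) (d := 0) (u := fun _ => 0) hw
      continuousAt_const (by
        filter_upwards [hd, hz'.deriv] with y h1 h2
        rw [← h1, h2]
        simp)
    simpa using this
  obtain ⟨m, ψ, hψ, hψ0, hm⟩ := hf.exists_eventuallyEq_pow_smul_nonzero_iff.2 hne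
  simp only [sub_zero, smul_eq_mul] at hm
  obtain ⟨k, rfl⟩ : ∃ k, m = k + 1 := by
    refine ⟨m - 1, ?_⟩
    rcases Nat.eq_zero_or_pos m with rfl | h
    · have := hm.self_of_nhds
      exact absurd (by simpa [hf0] using this.symm) hψ0
    · omega
  -- Differentiating `y ^ (k+1) * ψ` gives `y ^ k * u` with `u 0 ≠ 0`. Comparison with `y ^ s * w`
  -- forces `k = s` and fixes `ψ 0`.
  set u : ℝ → ℝ := fun y => (k + 1) * ψ y + y * deriv ψ y with hu
  have huc : ContinuousAt u 0 :=
    (continuousAt_const.mul hψ.continuousAt).add (continuousAt_id.mul hψ.deriv.continuousAt)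
  have hu0 : u 0 = (k + 1) * ψ 0 := by simp [hu]
  have hk : (k : ℝ) + 1 ≠ 0 := by positivity
  have hu0' : u 0 ≠ 0 := by
    rw [hu0]
    exact mul_ne_zero hk hψ0
  have hdu : ∀ᶠ y in 𝓝 0, y ^ s * w y = y ^ k * u y := by
    have hm' : f =ᶠ[𝓝 0] fun y => y ^ (k + 1) * ψ y := hm
    filter_upwards [hd, hm'.deriv, hψ.eventually_analyticAt] with y h1 h2 h3
    rw [← h1, h2, ((hasDerivAt_pow (k + 1) y).fun_mul h3.differentiableAt.hasDerivAt).deriv]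
    simp only [hu]
    push_cast
    ring
  have hsk : s = k := by
    rcases lt_trichotomy s k with h | h | h
    · obtain ⟨d, rfl⟩ := Nat.exists_eq_add_of_lt h
      have := eq_zero_pow_mul_of_pow_mul_eventuallyEq (a := s) (d := d + 1) hw huc hdu
      simp [hw0] at this
    · exact h
    · obtain ⟨d, rfl⟩ := Nat.exists_eq_add_of_lt h
      have := eq_zero_pow_mul_of_pow_mul_eventuallyEq (a := k) (d := d + 1) huc hw
        (hdu.mono fun y hy => hy.symm)
      simp [hu0'] at this
  subst hsk
  refine ⟨ψ, hψ, ?_, hm⟩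
  have := eq_zero_pow_mul_of_pow_mul_eventuallyEq (a := s) (d := 0) hw huc hdu
  rw [this, hu0]
  field_simp

theorem exists_phase_eq_pow_mul {r : ℕ} (hr : 1 ≤ r) :
    ∃ ψ : ℝ → ℝ, AnalyticAt ℝ ψ 0 ∧ ψ 0 = 1 / r.factorial ∧
      ∀ᶠ y in 𝓝 0, phase r y = y ^ r * ψ y := by
  obtain ⟨s, rfl⟩ : ∃ s, r = s + 1 := ⟨r - 1, by omega⟩
  have hq0 : (0 : ℝ) < q (s + 1) 0 := q_pos hr le_rfl
  have hφ : AnalyticAt ℝ (phase (s + 1)) 0 := analyticAt_id.sub ((analyticAt_q _ _).log hq0)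
  obtain ⟨ψ, h1, h2, h3⟩ := exists_eventually_eq_pow_succ_mul (s := s)
    (w := fun y => (s.factorial * q (s + 1) y)⁻¹) hφ (phase_zero_right hr)
    ((continuousAt_const.mul (continuous_q _).continuousAt).inv₀
      (mul_pos (by positivity) hq0).ne') (by positivity) (by
      filter_upwards [continuousAt_const.eventually_lt (continuous_q (s + 1)).continuousAt hq0]
        with y hy
      exact (hasDerivAt_phase s hy).deriv)
  refine ⟨ψ, h1, ?_, h3⟩
  rw [h2, q_zero_right hr, Nat.factorial_succ]
  push_cast
  field_simp

/-- The inverse substitution extends analytically through `0`, and its derivative is `g_r`. -/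
theorem exists_analyticAt_inverse {r : ℕ} (hr : 1 ≤ r) :
    ∃ Y : ℝ → ℝ, AnalyticAt ℝ Y 0 ∧ Y 0 = 0 ∧ ∃ ε > 0, ∀ t ∈ Set.Ioo 0 ε,
      0 < Y t ∧ phase r (Y t) = t ^ r / r.factorial ∧ HasDerivAt Y (g r t) t := by
  obtain ⟨ψ, hψ, hψ0, hφ⟩ := exists_phase_eq_pow_mul hr
  have hr0 : (r : ℝ) ≠ 0 := by positivity
  have hfac : (0 : ℝ) < r.factorial := by positivity
  have hψpos : 0 < r.factorial * ψ 0 := by rw [hψ0]; positivity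
  -- An analytic `r`-th root of `r! * ψ`, which equals 1 at 0. Thus `τ y = y * E y` satisfies `τ ^ r
  -- = r! * phase` near 0 with `τ' 0 = 1`, and can be inverted analytically.
  set E : ℝ → ℝ := fun y => Real.exp (Real.log (r.factorial * ψ y) / r) with hE
  have hEan : AnalyticAt ℝ E 0 := by
    have h1 : AnalyticAt ℝ (fun y => Real.log (r.factorial * ψ y)) 0 :=
      (analyticAt_const.mul hψ).log hψpos
    exact (h1.div analyticAt_const hr0).rexp
  have hE0 : E 0 = 1 := by
    simp only [hE, hψ0]
    rw [mul_one_div_cancel hfac.ne']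
    simp
  set τ : ℝ → ℝ := fun y => y * E y with hτ
  have hτan : AnalyticAt ℝ τ 0 := analyticAt_id.mul hEan
  have hτ0 : τ 0 = 0 := by simp [hτ]
  have hτd : deriv τ 0 = 1 := by
    have := ((hasDerivAt_id' (0 : ℝ)).fun_mul hEan.differentiableAt.hasDerivAt).deriv
    simpa [hE0] using this
  have hτd' : deriv τ 0 ≠ 0 := by simp [hτd]
  set Y := hτan.hasStrictDerivAt.localInverse _ _ _ hτd' with hY
  have hYan : AnalyticAt ℝ Y 0 := hτ0 ▸ hτan.analyticAt_localInverse hτd'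
  have hright : ∀ᶠ t in 𝓝 0, τ (Y t) = t := by
    have := hτan.hasStrictDerivAt.eventually_right_inverse hτd'
    rwa [hτ0] at this
  have hY0 : Y 0 = 0 := by
    have := (hτan.hasStrictDerivAt.eventually_left_inverse hτd').self_of_nhds
    rwa [hτ0] at this
  have hYt : Tendsto Y (𝓝 0) (𝓝 0) := by simpa [hY0] using hYan.continuousAt.tendsto
  have hψev : ∀ᶠ y in 𝓝 0, 0 < r.factorial * ψ y :=
    continuousAt_const.eventually_lt (continuousAt_const.mul hψ.continuousAt) hψpos
  have hall : ∀ᶠ t in 𝓝 0, τ (Y t) = t ∧ 0 < r.factorial * ψ (Y t) ∧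
      phase r (Y t) = Y t ^ r * ψ (Y t) ∧ AnalyticAt ℝ Y t := by
    filter_upwards [hright, hYt.eventually hψev, hYt.eventually hφ, hYan.eventually_analyticAt]
      with t h1 h2 h3 h4 using ⟨h1, h2, h3, h4⟩
  obtain ⟨ε, hε, hball⟩ := Metric.eventually_nhds_iff.1 hall
  have hmain : ∀ t ∈ Set.Ioo 0 ε, 0 < Y t ∧ phase r (Y t) = t ^ r / r.factorial ∧
      AnalyticAt ℝ Y t := by
    intro t ht
    obtain ⟨h1, h2, h3, h4⟩ := hball (y := t) (by
      rw [Real.dist_eq, sub_zero, abs_of_pos ht.1]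
      exact ht.2)
    refine ⟨?_, ?_, h4⟩
    · refine pos_of_mul_pos_left (b := E (Y t)) ?_ (Real.exp_pos _).le
      exact ht.1.trans_eq h1.symm
    · rw [h3, eq_div_iff hfac.ne']
      conv_rhs => rw [← h1]
      simp only [hτ, hE]
      rw [mul_pow, ← Real.exp_nat_mul, mul_div_cancel₀ _ hr0, Real.exp_log h2]
      ring
  refine ⟨Y, hYan, hY0, ε, hε, fun t ht => ?_⟩
  obtain ⟨hpos, hph, han⟩ := hmain t ht
  refine ⟨hpos, hph, ?_⟩
  have htOf : tOf r (Y t) = t := by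
    change ((r.factorial : ℝ) * phase r (Y t)) ^ (1 / (r : ℝ)) = t
    rw [hph, mul_div_cancel₀ _ hfac.ne', one_div, Real.pow_rpow_inv_natCast ht.1.le (by omega)]
  -- Injectivity of `tOf` on `[0, ∞)` identifies the chosen global inverse with the local one.
  have hyOf : yOf r t = Y t := by
    have := Function.invFunOn_mem (f := tOf r) (s := Set.Ici 0) (b := t) ⟨Y t, hpos.le, htOf⟩
    have h' := Function.invFunOn_eq (f := tOf r) (s := Set.Ici 0) (b := t) ⟨Y t, hpos.le, htOf⟩
    exact injOn_tOf hr this hpos.le (h'.trans htOf.symm)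
  have hd := han.differentiableAt.hasDerivAt
  obtain ⟨s, rfl⟩ : ∃ s, r = s + 1 := ⟨r - 1, by omega⟩
  have hqY := q_pos hr hpos.le
  have hc := (hasDerivAt_phase s hqY).comp t hd
  have hp : HasDerivAt (fun t : ℝ => t ^ (s + 1) / ((s + 1).factorial : ℝ))
      (((s + 1 : ℕ) : ℝ) * t ^ s / ((s + 1).factorial : ℝ)) t :=
    (hasDerivAt_pow (s + 1) t).div_const _
  have heq : (phase (s + 1) ∘ Y) =ᶠ[𝓝 t] fun t : ℝ => t ^ (s + 1) / ((s + 1).factorial : ℝ) := by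
    filter_upwards [Ioo_mem_nhds ht.1 ht.2] with x hx using (hmain x hx).2.1
  -- Two expressions for the derivative of `phase ∘ Y`; solving for `Y'` gives `g`.
  have hu := (hp.congr_of_eventuallyEq heq).unique hc
  suffices hg : g (s + 1) t = deriv Y t from hg ▸ hd
  rw [g, hyOf, Nat.add_sub_cancel]
  rw [Nat.factorial_succ] at hu
  push_cast at hu
  have hYs := pow_pos hpos s
  field_simp at hu ⊢
  linarith

end Birthday

/-! ### Laplace asymptotics and Watson's lemma -/

namespace Birthday

open Topology

section Laplace

/-- Contribution of a region on which the phase is at least `c`. -/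
theorem integrableOn_mul_exp_neg_mul {f θ : ℝ → ℝ} {S : Set ℝ} {c x : ℝ} (hS : MeasurableSet S)
    (hθ : ContinuousOn θ S) (hc : ∀ t ∈ S, c ≤ θ t)
    (hf : IntegrableOn (fun t => f t * Real.exp (-θ t)) S) (hx : 1 ≤ x) :
    IntegrableOn (fun t => f t * Real.exp (-(x * θ t))) S ∧
      ‖∫ t in S, f t * Real.exp (-(x * θ t))‖
        ≤ Real.exp (-((x - 1) * c)) * ∫ t in S, ‖f t * Real.exp (-θ t)‖ := by
  -- Splitting off the case `x = 1` leaves a factor bounded by `exp (-(x-1) c)`, so integrability at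
  -- `x = 1` suffices.
  have hsplit : ∀ t, f t * Real.exp (-(x * θ t))
      = Real.exp (-((x - 1) * θ t)) * (f t * Real.exp (-θ t)) := by
    intro t
    rw [mul_left_comm, ← Real.exp_add]
    congr 2
    ring
  have hbound : ∀ t ∈ S, ‖f t * Real.exp (-(x * θ t))‖
      ≤ Real.exp (-((x - 1) * c)) * ‖f t * Real.exp (-θ t)‖ := by
    intro t ht
    rw [hsplit, norm_mul, Real.norm_eq_abs (Real.exp _), Real.abs_exp]
    gcongr
    exact hc t ht
  have hdom := hf.norm.const_mul (Real.exp (-((x - 1) * c)))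
  have hae : ∀ᵐ t ∂volume.restrict S, ‖f t * Real.exp (-(x * θ t))‖
      ≤ Real.exp (-((x - 1) * c)) * ‖f t * Real.exp (-θ t)‖ :=
    (ae_restrict_iff' hS).2 (ae_of_all _ hbound)
  refine ⟨hdom.mono' ?_ hae, ?_⟩
  · simp only [hsplit]
    have hcont : ContinuousOn (fun t => Real.exp (-((x - 1) * θ t))) S :=
      Real.continuous_exp.comp_continuousOn (continuousOn_const.mul hθ).neg
    exact (hcont.aestronglyMeasurable hS).mul hf.aestronglyMeasurable
  · rw [← integral_const_mul]
    exact norm_integral_le_of_norm_le hdom hae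

/-- The integral is at most a constant times `exp (-c x)`. The exponent `b` is free, so a tail fits
any required error order. -/
theorem isBigO_integral_mul_exp_neg_mul {f θ : ℝ → ℝ} {S : Set ℝ} {c : ℝ} (hS : MeasurableSet S)
    (hθ : ContinuousOn θ S) (hc0 : 0 < c) (hc : ∀ t ∈ S, c ≤ θ t)
    (hf : IntegrableOn (fun t => f t * Real.exp (-θ t)) S) (b : ℝ) :
    (fun x : ℝ => ∫ t in S, f t * Real.exp (-(x * θ t))) =O[atTop] fun x : ℝ => x ^ b := by
  refine IsBigO.trans (g := fun x => Real.exp (-c * x)) ?_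
    (isLittleO_exp_neg_mul_rpow_atTop hc0 b).isBigO
  refine IsBigO.of_bound (Real.exp c * ∫ t in S, ‖f t * Real.exp (-θ t)‖) ?_
  filter_upwards [eventually_ge_atTop 1] with x hx
  refine (integrableOn_mul_exp_neg_mul hS hθ hc hf hx).2.trans_eq ?_
  rw [Real.norm_eq_abs, Real.abs_exp, mul_right_comm, ← Real.exp_add]
  congr 2
  ring

theorem integral_pow_mul_exp_neg_mul_pow_div {r : ℕ} (hr : 1 ≤ r) (i : ℕ) {b x : ℝ} (hb : 0 < b)
    (hx : 0 < x) :
    IntegrableOn (fun t : ℝ => t ^ i * Real.exp (-(x * (t ^ r / b)))) (Set.Ioi 0) ∧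
    ∫ t in Set.Ioi (0 : ℝ), t ^ i * Real.exp (-(x * (t ^ r / b)))
      = 1 / r * (Real.Gamma ((i + 1) / r) * (b / x) ^ (((i : ℝ) + 1) / r)) := by
  have hr' : (0 : ℝ) < r := by exact_mod_cast hr
  have hi : (-1 : ℝ) < i := by linarith [(Nat.cast_nonneg i : (0 : ℝ) ≤ i)]
  have hxb : 0 < x / b := by positivity
  have h : ∀ t : ℝ, t ^ i * Real.exp (-(x * (t ^ r / b)))
      = t ^ (i : ℝ) * Real.exp (-(x / b) * t ^ (r : ℝ)) := by
    intro t
    rw [Real.rpow_natCast, Real.rpow_natCast]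
    congr 2
    ring
  simp only [h]
  refine ⟨integrableOn_rpow_mul_exp_neg_mul_rpow hi hr' hxb, ?_⟩
  rw [integral_rpow_mul_exp_neg_mul_rpow hr' hi hxb, neg_div, Real.rpow_neg hxb.le,
    ← Real.inv_rpow hxb.le, inv_div]
  ring

/-- Watson's lemma for the phase `t ^ r / b` on a bounded interval. -/
theorem isBigO_watson {r : ℕ} (hr : 1 ≤ r) {b T C : ℝ} (hb : 0 < b) (hT : 0 < T) {G : ℝ → ℝ}
    {a : ℕ → ℝ} {N : ℕ} (hG : ContinuousOn G (Set.Icc 0 T))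
    (hC : ∀ t ∈ Set.Ioc 0 T, ‖G t - ∑ i ∈ Finset.range N, a i * t ^ i‖ ≤ C * t ^ N) :
    (fun x : ℝ => (∫ t in Set.Ioc 0 T, G t * Real.exp (-(x * (t ^ r / b))))
        - 1 / (r : ℝ) * ∑ i ∈ Finset.range N,
            a i * Real.Gamma (((i : ℝ) + 1) / r) * (b / x) ^ (((i : ℝ) + 1) / r))
      =O[atTop] fun x : ℝ => x ^ (-(((N : ℝ) + 1) / r)) := by
  have hr' : (0 : ℝ) < r := by exact_mod_cast hr
  set θ : ℝ → ℝ := fun t => t ^ r / b with hθ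
  have hθc : Continuous θ := by fun_prop
  have hmom : ∀ (i : ℕ) {x : ℝ}, 0 < x → _ := fun i {x} hx =>
    integral_pow_mul_exp_neg_mul_pow_div hr i hb hx
  have htail : ∀ i : ℕ, (fun x : ℝ => ∫ t in Set.Ioi T, t ^ i * Real.exp (-(x * θ t)))
      =O[atTop] fun x : ℝ => x ^ (-(((N : ℝ) + 1) / r)) := by
    intro i
    refine isBigO_integral_mul_exp_neg_mul measurableSet_Ioi hθc.continuousOn
      (c := T ^ r / b) (by positivity) (fun t ht => ?_) ?_ _
    · have : T ≤ t := le_of_lt ht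
      simp only [hθ]
      gcongr
    · have := (hmom i one_pos).1.mono_set (Set.Ioi_subset_Ioi hT.le)
      simpa [hθ] using this
  have hrem : (fun x : ℝ => ∫ t in Set.Ioc 0 T,
      (G t - ∑ i ∈ Finset.range N, a i * t ^ i) * Real.exp (-(x * θ t)))
      =O[atTop] fun x : ℝ => x ^ (-(((N : ℝ) + 1) / r)) := by
    refine IsBigO.of_bound (|C| * (1 / r * (Real.Gamma ((N + 1) / r) *
      b ^ (((N : ℝ) + 1) / r)))) ?_
    filter_upwards [eventually_gt_atTop 0] with x hx
    have hI := ((hmom N hx).1.const_mul |C|)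
    have hI' : IntegrableOn (fun t => |C| * (t ^ N * Real.exp (-(x * θ t)))) (Set.Ioc 0 T) :=
      IntegrableOn.mono_set hI Set.Ioc_subset_Ioi_self
    calc _ ≤ ∫ t in Set.Ioc 0 T, |C| * (t ^ N * Real.exp (-(x * θ t))) := by
          refine norm_integral_le_of_norm_le hI' ?_
          refine (ae_restrict_iff' measurableSet_Ioc).2 (ae_of_all _ fun t ht => ?_)
          rw [norm_mul, Real.norm_eq_abs (Real.exp _), Real.abs_exp, ← mul_assoc]
          gcongr
          refine (hC t ht).trans ?_
          have := ht.1.le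
          gcongr
          exact le_abs_self C
      _ ≤ ∫ t in Set.Ioi 0, |C| * (t ^ N * Real.exp (-(x * θ t))) := by
          refine setIntegral_mono_set hI ?_ Set.Ioc_subset_Ioi_self.eventuallyLE
          refine (ae_restrict_iff' measurableSet_Ioi).2 (ae_of_all _ fun t ht => ?_)
          have : (0 : ℝ) < t := ht
          positivity
      _ = _ := by
          rw [integral_const_mul, (hmom N hx).2, Real.norm_of_nonneg (by positivity),
            Real.rpow_neg hx.le, Real.div_rpow hb.le hx.le, div_eq_mul_inv]
          ring
  have hsum : (fun x : ℝ => ∑ i ∈ Finset.range N,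
      a i * ∫ t in Set.Ioi T, t ^ i * Real.exp (-(x * θ t)))
      =O[atTop] fun x : ℝ => x ^ (-(((N : ℝ) + 1) / r)) :=
    IsBigO.fun_sum fun i _ => (htail i).const_mul_left _
  -- The error is the Taylor remainder on `(0, T]` minus the tails over `(T, ∞)` that complete the
  -- monomial integrals to Gamma values.
  refine (hrem.sub hsum).congr' ?_ EventuallyEq.rfl
  filter_upwards [eventually_gt_atTop 0] with x hx
  have hGi : IntegrableOn (fun t => G t * Real.exp (-(x * θ t))) (Set.Ioc 0 T) :=
    ((hG.mul (by fun_prop)).integrableOn_Icc).mono_set Set.Ioc_subset_Icc_self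
  have hpi : ∀ i ∈ Finset.range N,
      IntegrableOn (fun t => a i * (t ^ i * Real.exp (-(x * θ t)))) (Set.Ioc 0 T) := fun i _ =>
    IntegrableOn.mono_set ((hmom i hx).1.const_mul _) Set.Ioc_subset_Ioi_self
  simp only [sub_mul, Finset.sum_mul, mul_assoc]
  rw [integral_sub hGi (integrable_finsetSum _ hpi), integral_finsetSum _ hpi, sub_sub,
    ← Finset.sum_add_distrib, Finset.mul_sum]
  congr 1
  refine Finset.sum_congr rfl fun i _ => ?_
  rw [integral_const_mul, ← mul_add, ← setIntegral_union (Set.Ioc_disjoint_Ioi le_rfl)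
    measurableSet_Ioi ((hmom i hx).1.mono_set Set.Ioc_subset_Ioi_self)
    ((hmom i hx).1.mono_set (Set.Ioi_subset_Ioi hT.le)), Set.Ioc_union_Ioi_eq_Ioi hT.le,
    (hmom i hx).2]
  ring

end Laplace

/-! ### Assembling the expansion -/

/-- The power series of `g_r` gives the asymptotic expansion of the Laplace integral. -/
theorem exists_expansion {r : ℕ} (hr : 1 ≤ r) :
    ∃ a : ℕ → ℝ,
      (∃ ε > 0, ∀ t ∈ Set.Ioo (0 : ℝ) ε, HasSum (fun i => a i * t ^ i) (g r t)) ∧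
      ∀ N : ℕ, (fun x : ℝ => (∫ y in Set.Ioi (0 : ℝ), Real.exp (-(x * phase r y)))
          - 1 / (r : ℝ) * ∑ i ∈ Finset.range N,
            a i * Real.Gamma (((i : ℝ) + 1) / r) * ((r.factorial : ℝ) / x) ^ (((i : ℝ) + 1) / r))
        =O[atTop] fun x : ℝ => x ^ (-(((N : ℝ) + 1) / r)) := by
  obtain ⟨Y, hYan, hY0, ε, hε, hY⟩ := exists_analyticAt_inverse hr
  obtain ⟨p, hp⟩ := hYan.deriv
  refine ⟨p.coeff, ?_, fun N => ?_⟩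
  · obtain ⟨δ, hδ, hball⟩ := Metric.eventually_nhds_iff.1 (hasFPowerSeriesAt_iff.1 hp)
    refine ⟨min ε δ, lt_min hε hδ, fun t ht => ?_⟩
    have := hball (y := t) (by
      rw [Real.dist_eq, sub_zero, abs_of_pos ht.1]
      exact ht.2.trans_le (min_le_right _ _))
    rw [zero_add, (hY t ⟨ht.1, ht.2.trans_le (min_le_left _ _)⟩).2.2.deriv] at this
    simpa [mul_comm] using this
  · obtain ⟨C, hC⟩ := (hp.isBigO_sub_partialSum_pow N).bound
    obtain ⟨δ, hδ, hball⟩ := Metric.eventually_nhds_iff.1 (hC.and hYan.eventually_analyticAt)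
    obtain ⟨T, hT0, hTm⟩ := exists_between (lt_min hε hδ)
    have hTε := hTm.trans_le (min_le_left _ _)
    have hTδ := hTm.trans_le (min_le_right _ _)
    have hnear : ∀ t ∈ Set.Icc 0 T, _ := fun t ht => hball (y := t) (by
      rw [Real.dist_eq, sub_zero, abs_of_nonneg ht.1]
      exact ht.2.trans_lt hTδ)
    have hYT := hY T ⟨hT0, hTε⟩
    have hdc : ContinuousOn (deriv Y) (Set.Icc 0 T) := fun t ht =>
      (hnear t ht).2.deriv.continuousAt.continuousWithinAt
    have hYnn : ∀ t ∈ Set.Icc 0 T, 0 ≤ Y t ∧ phase r (Y t) = t ^ r / r.factorial := by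
      intro t ht
      rcases ht.1.eq_or_lt with rfl | h0
      · rw [hY0, phase_zero_right hr, zero_pow (by omega)]
        simp
      · obtain ⟨h1, h2, -⟩ := hY t ⟨h0, ht.2.trans_lt hTε⟩
        exact ⟨h1.le, h2⟩
    have hW := isBigO_watson hr (b := r.factorial) (by positivity) hT0 (a := p.coeff) (N := N)
      (C := C) hdc (by
        intro t ht
        have := (hnear t ⟨ht.1.le, ht.2⟩).1
        rw [zero_add, FormalMultilinearSeries.partialSum] at this
        simpa [abs_of_pos ht.1, mul_comm] using this)
    -- Integrability at `x = 1` is the case `n = 1` of the word-counting integral.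
    have hint1 : IntegrableOn (fun y => (1 : ℝ) * Real.exp (-phase r y)) (Set.Ioi 0) := by
      have := (integral_q_pow_mul_exp one_pos r (Nat.lt_succ_self _)).1
      refine this.congr_fun (fun y hy => ?_) measurableSet_Ioi
      have := exp_neg_mul_phase hr 1 (le_of_lt hy)
      simp only [Nat.cast_one, one_mul] at this ⊢
      exact this.symm
    have htail := isBigO_integral_mul_exp_neg_mul (S := Set.Ioi (Y T)) (c := phase r (Y T))
      measurableSet_Ioi ((continuousOn_phase hr).mono fun y hy => hYT.1.le.trans (le_of_lt hy))
      (by rw [hYT.2.1]; positivity)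
      (fun y hy => (strictMonoOn_phase hr).monotoneOn hYT.1.le (hYT.1.le.trans (le_of_lt hy))
        (le_of_lt hy)) (hint1.mono_set (Set.Ioi_subset_Ioi hYT.1.le)) (-(((N : ℝ) + 1) / r))
    refine (hW.add htail).congr' ?_ EventuallyEq.rfl
    filter_upwards [eventually_ge_atTop 1] with x hx
    have hintx := (integrableOn_mul_exp_neg_mul (c := 0) measurableSet_Ioi
      ((continuousOn_phase hr).mono Set.Ioi_subset_Ici_self)
      (fun y hy => phase_nonneg hr (le_of_lt hy)) hint1 hx).1
    simp only [one_mul] at hintx ⊢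
    -- Substitute `y = Y t`; the tail beyond `Y T` is then rejoined to give the full integral.
    have hsub : ∫ t in Set.Ioc 0 T, deriv Y t * Real.exp (-(x * (t ^ r / r.factorial)))
        = ∫ y in Set.Ioc 0 (Y T), Real.exp (-(x * phase r y)) := by
      rw [← intervalIntegral.integral_of_le hT0.le, ← intervalIntegral.integral_of_le hYT.1.le]
      have hcv := intervalIntegral.integral_comp_mul_deriv' (a := 0) (b := T) (f := Y)
        (f' := deriv Y) (g := fun y => Real.exp (-(x * phase r y)))
        (fun t ht => by
          rw [Set.uIcc_of_le hT0.le] at ht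
          exact (hnear t ht).2.differentiableAt.hasDerivAt)
        (by rwa [Set.uIcc_of_le hT0.le])
        (by
          refine Real.continuous_exp.comp_continuousOn (continuousOn_const.mul
            ((continuousOn_phase hr).mono ?_)).neg
          rw [Set.uIcc_of_le hT0.le]
          rintro _ ⟨t, ht, rfl⟩
          exact (hYnn t ht).1)
      rw [hY0] at hcv
      rw [← hcv]
      refine intervalIntegral.integral_congr fun t ht => ?_
      rw [Set.uIcc_of_le hT0.le] at ht
      simp only [Function.comp_apply, (hYnn t ht).2]
      ring
    rw [hsub, sub_add_eq_add_sub, ← setIntegral_union (Set.Ioc_disjoint_Ioi le_rfl)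
      measurableSet_Ioi (hintx.mono_set Set.Ioc_subset_Ioi_self)
      (hintx.mono_set (Set.Ioi_subset_Ioi hYT.1.le)), Set.Ioc_union_Ioi_eq_Ioi hYT.1.le]

end Birthday

theorem mainTheorem8 (r : ℕ) (hr : 2 ≤ r) :
    ∃ a : ℕ → ℝ,
      (∃ ε > 0, ∀ t ∈ Set.Ioo (0 : ℝ) ε, HasSum (fun i => a i * t ^ i) (Birthday.g r t)) ∧
      ∀ (Ω : ℕ+ → Type*) [∀ n, MeasurableSpace (Ω n)] (P : ∀ n, Measure (Ω n))
        [∀ n, IsProbabilityMeasure (P n)]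
        (h : ∀ n : ℕ+, Fin n → Fin n) (D : ∀ n : ℕ+, ℕ → Ω n → Fin n),
        (∀ n i, Birthday.configuration (h n) i = 1) →
        (∀ n, Birthday.IsDrawingWithReplacement (P n) (D n)) →
        (∀ n, Birthday.expectedRepetitionTime (P n) (h n) (D n) r ≠ ⊤) ∧
        ∀ N : ℕ,
          (fun n : ℕ+ =>
            (Birthday.expectedRepetitionTime (P n) (h n) (D n) r).toReal / ((n : ℕ) : ℝ)
              - 1 / (r : ℝ) * ∑ i ∈ Finset.range N,
                  a i * Real.Gamma (((i : ℝ) + 1) / (r : ℝ))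
                    * ((r.factorial : ℝ) / ((n : ℕ) : ℝ)) ^ (((i : ℝ) + 1) / (r : ℝ)))
          =O[atTop] fun n : ℕ+ => (((n : ℕ) : ℝ) ^ (-1 / (r : ℝ))) ^ (N + 1) := by
  have hr1 : 1 ≤ r := by omega
  obtain ⟨a, ha, hexp⟩ := Birthday.exists_expansion hr1
  refine ⟨a, ha, fun Ω _ P _ h D hh hD => ?_⟩
  have hE := fun n => Birthday.expectedRepetitionTime_eq n.pos (hh n) (hD n) hr1
  refine ⟨fun n => by rw [hE]; exact ENNReal.ofReal_ne_top, fun N => ?_⟩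
  have htend : Tendsto (fun n : ℕ+ => ((n : ℕ) : ℝ)) atTop atTop :=
    tendsto_natCast_atTop_atTop.comp tendsto_PNat_val_atTop_atTop
  refine ((hexp N).comp_tendsto htend).congr (fun n => ?_) (fun n => ?_)
  · have hn : (0 : ℝ) < (n : ℕ) := by exact_mod_cast n.pos
    have hI : ∫ y in Set.Ioi (0 : ℝ), Real.exp (-((n : ℕ) * Birthday.phase r y))
        = ∫ y in Set.Ioi (0 : ℝ), Birthday.q r y ^ (n : ℕ) * Real.exp (-((n : ℕ) * y)) :=
      setIntegral_congr_fun measurableSet_Ioi fun y hy =>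
        Birthday.exp_neg_mul_phase hr1 n (le_of_lt hy)
    have hI0 : 0 ≤ ∫ y in Set.Ioi (0 : ℝ), Real.exp (-((n : ℕ) * Birthday.phase r y)) :=
      integral_nonneg fun y => (Real.exp_pos _).le
    simp only [Function.comp_apply]
    -- Dividing by `n` removes the prefactor of the Laplace integral, leaving the expansion at `x =
    -- n`.
    rw [hE, ← hI, ENNReal.toReal_ofReal (by positivity), mul_div_cancel_left₀ _ hn.ne']
  · simp only [Function.comp_apply]
    rw [← Real.rpow_natCast, ← Real.rpow_mul (Nat.cast_nonneg _)]
    congr 1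
    push_cast
    ring
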